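/- Let $F$ be a field, $\tilde F$ a separable closure of $F$, $l$ a prime and $n>0$ an integer. A finite separable extension $E$ of $F$ with $[E:F]>1$ is called primitive if its only intermediate fields are $F$ and $E$; it is called solvable if $\mathrm{Gal}(\hat E|F)$ is solvable, where $\hat E\subset\tilde F$ is the Galois closure of $E$ over $F$, i.e. the compositum of the images of all $F$-embeddings $E\to\tilde F$. A *pair* $(\rho,D)$ consists of a continuous irreducible representation $\rho$ of $\mathrm{Gal}(\tilde F|F)$, with solvable image, on an $\mathbf F_l$-space $N$ of dimension $n$, and an extension $D\subset\tilde F$ of the fixed field $K$ of $\ker\rho$ such that $D$ is Galois over $F$ and there is an isomorphism of groups $N\simeq\mathrm{Gal}(D|K)$ under which the conjugation action of $\mathrm{Gal}(\tilde F|F)$ (through $\mathrm{Gal}(D|F)$) on $\mathrm{Gal}(D|K)$ is given by $\rho$. Two pairs $(\rho,D)$ and $(\rho',D')$ are identified if $\rho\simeq\rho'$ and $D=D'$. A pair $(\rho,D)$ is said to be *attached* to a solvable primitive extension $E$ of $F$ if $D=\hat E$ and $\rho$ is isomorphic to the conjugation representation of $\mathrm{Gal}(\tilde F|F)$ on a minimal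 normal subgroup of $\mathrm{Gal}(\hat E|F)$. Then: 1. Every pair $(\rho,D)$ is attached to a solvable primitive extension $E$ of $F$ of degree $l^n$, and every solvable primitive extension $E'$ of $F$ with $\hat E'=D$ is $F$-isomorphic to $E$. Moreover $\mathrm{Gal}(D|F)\simeq\mathrm{Gal}(D|K)\rtimes_\rho\mathrm{Gal}(K|F)$, where $\mathrm{Gal}(K|F)$ acts on $\mathrm{Gal}(D|K)\simeq N$ through $\rho$; the isomorphism can be chosen compatible with the inclusion of $\mathrm{Gal}(D|K)$ in $\mathrm{Gal}(D|F)$ and with the restriction $\mathrm{Gal}(D|F)\to\mathrm{Gal}(K|F)$. 2. Every solvable primitive extension $E$ of $F$ of degree $l^n$ has an attached pair, and whenever $D=\hat E$ and a representation $\rho$ of $\mathrm{Gal}(\tilde F|F)$ on an $\mathbf F_l$-space is isomorphic to the conjugation representation on a minimal normal subgroup of $\mathrm{Gal}(\hat E|F)$, $(\rho,D)$ is a pair as above. 3. Sending $E$ to its attached pair is a bijection from the set of $F$-isomorphism classes of solvable primitive extensions of $F$ of degree $l^n$ onto the set of isomorphism classes of pairs $(\rho,D)$. 4. Two solvable primitive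 extensions $E,E'$ of $F$ with $\hat E=\hat E'$ are $F$-isomorphic. 5. A Galois extension $D\subset\tilde F$ of $F$ is of the form $\hat E$ for some solvable primitive extension $E$ of $F$ of degree $l^n$ if and only if there is a $\rho$ such that $(\rho,D)$ is a pair as above. -/

import Mathlib

universe u v w x y

namespace SolvablePrimitive

/-- A finite separable extension `E` of `F`, of degree `> 1`, is primitive if its only intermediate
fields are `F` and `E`. -/
structure IsPrimitiveExtension (F : Type u) [Field F] (E : Type x) [Field E] [Algebra F E] :
    Prop where
  finiteDimensional : FiniteDimensional F E
  isSeparable : Algebra.IsSeparable F E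
  one_lt_finrank : 1 < Module.finrank F E
  eq_bot_or_eq_top : ∀ L : IntermediateField F E, L = ⊥ ∨ L = ⊤

/-- A primitive extension `E` of `F` is solvable if `Gal(Ê|F)` is solvable, where `Ê` is the Galois
closure of `E` over `F`, realised as the subfield of the separable closure `Ft` generated by the
images of all `F`-embeddings of `E`. -/
structure IsSolvablePrimitive (F : Type u) [Field F] (Ft : Type v) [Field Ft] [Algebra F Ft]
    (E : Type x) [Field E] [Algebra F E] : Prop where
  isPrimitive : IsPrimitiveExtension F E
  isSolvable : Group.IsSolvable Gal(IntermediateField.normalClosure F E Ft/F)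

/-- A minimal normal subgroup: a nontrivial normal subgroup which contains no normal subgroup of
the ambient group other than `1` and itself. -/
structure IsMinimalNormal {G : Type*} [Group G] (N : Subgroup G) : Prop where
  normal : N.Normal
  ne_bot : N ≠ ⊥
  eq_bot_or_eq : ∀ H : Subgroup G, H.Normal → H ≤ N → H = ⊥ ∨ H = N

section

variable {F : Type u} [Field F] {Ft : Type v} [Field Ft] [Algebra F Ft]

/-- `Gal(D|K)`, as a subgroup of `Gal(D|F)`. -/
def relGal {K D : IntermediateField F Ft} (h : K ≤ D) : Subgroup Gal(D/F) :=
  (IntermediateField.restrict h).fixingSubgroup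

variable {l : ℕ} [Fact l.Prime] {N : Type w} [AddCommGroup N] [Module (ZMod l) N]

/-- The fixed field `K` of the kernel of `ρ`. -/
def kerField (ρ : Representation (ZMod l) Gal(Ft/F) N) : IntermediateField F Ft :=
  IntermediateField.fixedField ρ.asGroupHom.ker

instance [IsGalois F Ft] (ρ : Representation (ZMod l) Gal(Ft/F) N) : IsGalois F (kerField ρ) :=
  IsGalois.of_fixedField_normal_subgroup ρ.asGroupHom.ker

/-- Under the identification `e` of the space of `ρ` with the subgroup `A` of `Gal(D|F)`,
conjugation in `Gal(D|F)` is given by `ρ`. -/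
def ConjugationGivenBy [IsGalois F Ft] (ρ : Representation (ZMod l) Gal(Ft/F) N)
    {D : IntermediateField F Ft} [Normal F D] {A : Subgroup Gal(D/F)}
    (e : Multiplicative N ≃* A) : Prop :=
  ∀ (σ : Gal(Ft/F)) (y : N),
    (e (Multiplicative.ofAdd (ρ σ y)) : Gal(D/F)) =
      AlgEquiv.restrictNormalHom D σ * (e (Multiplicative.ofAdd y) : Gal(D/F)) *
        (AlgEquiv.restrictNormalHom D σ)⁻¹

/-- The pairs `(ρ, D)`: `ρ` is a continuous irreducible representation of `Gal(Ft|F)`, with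
solvable image, on an `𝔽_l`-space `N` of dimension `n`, and `D` is an extension of the fixed field
`K` of `ker ρ` which is Galois over `F`, with `Gal(D|K)` isomorphic to `N` in such a way that the
conjugation action on `Gal(D|K)` is given by `ρ`. -/
structure IsParameter (n : ℕ) [IsGalois F Ft] (ρ : Representation (ZMod l) Gal(Ft/F) N)
    (D : IntermediateField F Ft) : Prop where
  finrank_eq : Module.finrank (ZMod l) N = n
  isOpen_ker : IsOpen (ρ.asGroupHom.ker : Set Gal(Ft/F))
  irreducible : ρ.IsIrreducible
  solvable_image : Group.IsSolvable ρ.asGroupHom.range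
  isGalois : IsGalois F D
  le : kerField ρ ≤ D
  conj : ∃ e : Multiplicative N ≃* relGal le, ConjugationGivenBy ρ e

/-- `(ρ, D)` is the pair attached to the extension `E`: `D` is the Galois closure `Ê`, and `ρ` is
(up to isomorphism) the conjugation representation of `Gal(Ft|F)`, through its quotient
`Gal(Ê|F)`, on a minimal normal subgroup of `Gal(Ê|F)`. -/
structure IsAttached [IsGalois F Ft] (E : Type x) [Field E] [Algebra F E]
    (ρ : Representation (ZMod l) Gal(Ft/F) N) (D : IntermediateField F Ft) : Prop where
  closure_eq : IntermediateField.normalClosure F E Ft = D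
  conj : ∃ A : Subgroup Gal(IntermediateField.normalClosure F E Ft/F), IsMinimalNormal A ∧
    ∃ e : Multiplicative N ≃* A, ConjugationGivenBy ρ e

end

/-- The solvable primitive extensions of `F` of degree `l ^ n` inside the separable closure. -/
def Ext (l n : ℕ) (F : Type u) [Field F] (Ft : Type v) [Field Ft] [Algebra F Ft] : Type v :=
  {E : IntermediateField F Ft // IsSolvablePrimitive F Ft E ∧ Module.finrank F E = l ^ n}

/-- `F`-isomorphism of extensions. -/
instance Ext.setoid (l n : ℕ) (F : Type u) [Field F] (Ft : Type v) [Field Ft] [Algebra F Ft] :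
    Setoid (Ext l n F Ft) where
  r E E' := Nonempty (E.1 ≃ₐ[F] E'.1)
  iseqv := ⟨fun _ => ⟨AlgEquiv.refl⟩, fun ⟨f⟩ => ⟨f.symm⟩, fun ⟨f⟩ ⟨g⟩ => ⟨f.trans g⟩⟩

/-- The pairs `(ρ, D)`, with `ρ` a representation on the standard `n`-dimensional space. -/
structure Param (l n : ℕ) [Fact l.Prime] (F : Type u) [Field F] (Ft : Type v) [Field Ft]
    [Algebra F Ft] [IsGalois F Ft] where
  ρ : Representation (ZMod l) Gal(Ft/F) (Fin n → ZMod l)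
  D : IntermediateField F Ft
  isParameter : IsParameter n ρ D

/-- Two pairs `(ρ, D)`, `(ρ', D')` are identified if `ρ` is isomorphic to `ρ'` and `D = D'`. -/
instance Param.setoid (l n : ℕ) [Fact l.Prime] (F : Type u) [Field F] (Ft : Type v) [Field Ft]
    [Algebra F Ft] [IsGalois F Ft] : Setoid (Param l n F Ft) where
  r p q := Nonempty (Representation.Equiv p.ρ q.ρ) ∧ p.D = q.D
  iseqv := ⟨fun p => ⟨⟨Representation.Equiv.refl p.ρ⟩, rfl⟩,
    fun ⟨⟨f⟩, h⟩ => ⟨⟨f.symm⟩, h.symm⟩, fun ⟨⟨f⟩, h⟩ ⟨⟨g⟩, h'⟩ => ⟨⟨f.trans g⟩, h.trans h'⟩⟩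

end SolvablePrimitive

/-! Galois theory inside `D = Ê` turns a solvable primitive `E` with closure `D` into a core-free
maximal subgroup `M` of the finite solvable group `G = Gal(D|F)`; conjugate subgroups give
isomorphic extensions. For such an `M`, a minimal normal subgroup `A` of `G` is elementary abelian,
is complemented by `M` and satisfies `C_G(A) = A`. Hence `A` is the only minimal normal subgroup,
and `[E:F] = |A|`.

Conversely, let `A` be minimal normal with `C_G(A) = A`. Then `A` has a complement
(`IsMinimalNormal.exists_isComplement'`), all complements are conjugate
(`IsMinimalNormal.isConj_of_isComplement'`), and each is maximal and core-free. For existence and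
conjugacy, choose `B/A` minimal normal in `G/A` (when `A ≠ G`). It is a `p`-group with `p ≠ l`, and
the complements of `A` in `G` are the normalizers of the Sylow `p`-subgroups of `B`.

For pairs, irreducibility of `ρ` is minimality of `Gal(D|K)`. Since the kernel of a conjugation
representation on `A` is the preimage of `C_G(A)`, defining `K` by `ker ρ` amounts to saying that
`Gal(D|K)` is its own centralizer. Thus both kinds of object are governed by `D` alone: it
determines `E` and `ρ` up to isomorphism. -/

namespace SolvablePrimitive

/-! ### Minimal normal subgroups and core-free maximal subgroups -/

section GroupTheory

open Subgroup

variable {G : Type*} [Group G]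

lemma exists_isMinimalNormal_le [Finite G] {H : Subgroup G} (hn : H.Normal) (hH : H ≠ ⊥) :
    ∃ A : Subgroup G, A ≤ H ∧ IsMinimalNormal A := by
  obtain ⟨A, ⟨hA, hA0, hAH⟩, hmin⟩ :=
    (Set.toFinite {K : Subgroup G | K.Normal ∧ K ≠ ⊥ ∧ K ≤ H}).exists_minimal ⟨H, hn, hH, le_rfl⟩
  refine ⟨A, hAH, hA, hA0, fun K hK hKA => or_iff_not_imp_left.2 fun hK0 => ?_⟩
  exact le_antisymm hKA (hmin ⟨hK, hK0, hKA.trans hAH⟩ hKA)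

lemma normal_of_sup_eq_top {H M A : Subgroup G} (hM : M ≤ normalizer (H : Set G))
    (hA : A ≤ normalizer (H : Set G)) (h : A ⊔ M = ⊤) : H.Normal := by
  rw [← normalizer_eq_top_iff, eq_top_iff, ← h]
  exact sup_le hA hM

lemma le_normalizer_inf_left (M A : Subgroup G) [hA : A.Normal] :
    M ≤ normalizer ((A ⊓ M : Subgroup G) : Set G) := by
  intro m hm
  rw [mem_normalizer_iff]
  intro h
  refine and_congr ⟨fun h' => hA.conj_mem _ h' _, fun h' => ?_⟩
    ((M.mul_mem_cancel_right (M.inv_mem hm)).trans (M.mul_mem_cancel_left hm)).symm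
  simpa [mul_assoc] using hA.conj_mem _ h' m⁻¹

lemma le_normalizer_of_le_centralizer {A H : Subgroup G} (hc : A ≤ centralizer (A : Set G))
    (h : H ≤ A) : A ≤ normalizer (H : Set G) :=
  (hc.trans (centralizer_le h)).trans (centralizer_le_normalizer _)

namespace IsMinimalNormal

variable {A : Subgroup G}

/-- By solvability `[A, A]` is strictly smaller than `A`; being normal in `G`, it is trivial. -/
lemma le_centralizer [Group.IsSolvable G] (h : IsMinimalNormal A) :
    A ≤ centralizer (A : Set G) := by
  have := h.normal
  have hlt := Group.IsSolvable.commutator_lt_of_ne_bot h.ne_bot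
  rw [← commutator_eq_bot_iff_le_centralizer]
  exact (h.eq_bot_or_eq _ inferInstance hlt.le).resolve_right hlt.ne

/-- As `A` is abelian, its elements killed by `p` form a subgroup, normal in `G`. Cauchy's theorem
makes it nontrivial for a prime `p` dividing `|A|`, so it is all of `A`. -/
lemma exists_prime_forall_pow_eq_one [Finite G] (h : IsMinimalNormal A)
    (hc : A ≤ centralizer (A : Set G)) :
    ∃ p : ℕ, p.Prime ∧ ∀ a ∈ A, a ^ p = 1 := by
  have hcard : Nat.card A ≠ 1 := fun h1 => h.ne_bot (A.eq_bot_of_card_eq h1)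
  obtain ⟨p, hp, hpA⟩ := Nat.exists_prime_and_dvd hcard
  have := Fact.mk hp
  obtain ⟨x, hx⟩ := exists_prime_orderOf_dvd_card' p hpA
  let K : Subgroup G :=
    { carrier := {a | a ∈ A ∧ a ^ p = 1}
      one_mem' := ⟨A.one_mem, one_pow _⟩
      mul_mem' := fun {a b} ha hb => ⟨A.mul_mem ha.1 hb.1, by
        have hab : Commute a b := (hc hb.1 a ha.1)
        rw [hab.mul_pow, ha.2, hb.2, one_mul]⟩
      inv_mem' := fun {a} ha => ⟨A.inv_mem ha.1, by rw [inv_pow, ha.2, inv_one]⟩ }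
  have hK : K = A := by
    refine (h.eq_bot_or_eq K ⟨fun a ha g => ⟨h.normal.conj_mem a ha.1 g, ?_⟩⟩
      fun a ha => ha.1).resolve_left fun hb => ?_
    · rw [conj_pow, ha.2, mul_one, mul_inv_cancel]
    · have hxK : (x : G) ∈ K := ⟨x.2, by
        rw [← hx, ← Subgroup.orderOf_coe]; exact pow_orderOf_eq_one _⟩
      rw [hb, mem_bot] at hxK
      rw [← Subgroup.orderOf_coe, hxK, orderOf_one] at hx
      exact hp.one_lt.ne hx
  exact ⟨p, hp, fun a ha => (hK.symm ▸ ha : a ∈ K).2⟩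

/-- `A ⊓ M` is normalized by `M` because `A` is normal, and by `A` because `A` is abelian; so it is
normal in `G = AM`. -/
lemma inf_eq_bot_of_sup_eq_top (h : IsMinimalNormal A) (hc : A ≤ centralizer (A : Set G))
    {M : Subgroup G} (hsup : A ⊔ M = ⊤) (hM : ¬ A ≤ M) : A ⊓ M = ⊥ := by
  have := h.normal
  refine (h.eq_bot_or_eq _ (normal_of_sup_eq_top (le_normalizer_inf_left M A)
    (le_normalizer_of_le_centralizer hc inf_le_left) hsup) inf_le_left).resolve_right fun he => ?_
  exact hM (inf_eq_left.1 he)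

lemma isComplement'_of_sup_eq_top (h : IsMinimalNormal A) (hc : A ≤ centralizer (A : Set G))
    {M : Subgroup G} (hsup : A ⊔ M = ⊤) (hM : ¬ A ≤ M) : IsComplement' A M := by
  have := h.normal
  refine isComplement'_of_disjoint_and_mul_eq_univ
    (disjoint_iff.2 (h.inf_eq_bot_of_sup_eq_top hc hsup hM)) ?_
  rw [← normal_mul, hsup, coe_top]

/-- A core-free maximal subgroup of a solvable group is a complement of every minimal normal
subgroup. -/
lemma isComplement'_of_isCoatom [Group.IsSolvable G] (h : IsMinimalNormal A) {M : Subgroup G}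
    (hM : IsCoatom M) (hcore : ∀ H : Subgroup G, H.Normal → H ≤ M → H = ⊥) :
    IsComplement' A M := by
  have hAM : ¬ A ≤ M := fun hle => h.ne_bot (hcore A h.normal hle)
  refine h.isComplement'_of_sup_eq_top h.le_centralizer ?_ hAM
  rw [sup_comm]
  exact hM.2 _ (left_lt_sup.2 hAM)

end IsMinimalNormal

/-- Dedekind's modular law: `L = (A ⊓ L) M`. -/
lemma eq_of_isComplement'_of_le {A M L : Subgroup G} (h : IsComplement' A M) (hML : M ≤ L)
    (hAL : A ⊓ L = ⊥) : M = L := by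
  refine le_antisymm hML fun x hx => ?_
  obtain ⟨⟨a, m⟩, rfl⟩ := h.2 x
  have ha : (a : G) ∈ A ⊓ L := ⟨a.2, (L.mul_mem_cancel_right (hML m.2)).1 hx⟩
  rw [hAL, mem_bot] at ha
  simp [ha]

lemma exists_mul_eq_of_isComplement' {A M : Subgroup G} (h : IsComplement' A M) (g : G) :
    ∃ a ∈ A, ∃ m ∈ M, a * m = g := by
  obtain ⟨⟨a, m⟩, rfl⟩ := h.2 g
  exact ⟨a, a.2, m, m.2, rfl⟩

/-- `C(A) ⊓ M` is normalized by `M` and centralized by `A`, hence normal, hence trivial. Since `A ≤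
C(A)`, the modular law gives `C(A) = A (C(A) ⊓ M) = A`. -/
lemma centralizer_eq_of_coreFree_isComplement' {A M : Subgroup G} [hA : A.Normal]
    (hc : A ≤ centralizer (A : Set G)) (h : IsComplement' A M)
    (hcore : ∀ H : Subgroup G, H.Normal → H ≤ M → H = ⊥) :
    centralizer (A : Set G) = A := by
  have hn : (centralizer (A : Set G) ⊓ M).Normal := by
    refine normal_of_sup_eq_top (le_normalizer_inf_left M _) ?_ h.sup_eq_top
    refine le_trans ?_ (centralizer_le_normalizer _)
    rw [le_centralizer_iff]
    exact inf_le_left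
  refine le_antisymm (fun x hx => ?_) hc
  obtain ⟨a, ha, m, hm, rfl⟩ := exists_mul_eq_of_isComplement' h x
  have : m ∈ centralizer (A : Set G) ⊓ M :=
    ⟨((centralizer (A : Set G)).mul_mem_cancel_left (hc ha)).1 hx, hm⟩
  rw [hcore _ hn inf_le_right, mem_bot] at this
  simpa [this] using ha

namespace IsMinimalNormal

variable {A : Subgroup G}

/-- Distinct minimal normal subgroups meet trivially and so commute, which would put `B` inside
`C(A) = A`. -/
lemma eq_of_centralizer_eq [Group.IsSolvable G] (h : IsMinimalNormal A)
    (hc : centralizer (A : Set G) = A) {B : Subgroup G} (hB : IsMinimalNormal B) : A = B := by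
  have := h.normal
  have := hB.normal
  by_contra hne
  have hinf : A ⊓ B = ⊥ := by
    refine (h.eq_bot_or_eq _ inferInstance inf_le_left).resolve_right fun he => ?_
    exact (hB.eq_bot_or_eq A h.normal (inf_eq_left.1 he)).elim h.ne_bot hne
  have hBA : B ≤ A := by
    rw [← hc, ← commutator_eq_bot_iff_le_centralizer, ← le_bot_iff, ← hinf, inf_comm]
    exact commutator_le_inf B A
  rw [inf_eq_right.2 hBA] at hinf
  exact hB.ne_bot hinf

lemma isCoatom_of_isComplement' (h : IsMinimalNormal A) (hc : A ≤ centralizer (A : Set G))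
    {M : Subgroup G} (hM : IsComplement' A M) : IsCoatom M := by
  refine ⟨fun ht => h.ne_bot ?_, fun L hL => ?_⟩
  · simpa [ht] using hM
  · have hsup : A ⊔ L = ⊤ := by
      rw [eq_top_iff, ← hM.sup_eq_top]
      exact sup_le_sup_left hL.le _
    by_cases hAL : A ≤ L
    · rwa [sup_eq_right.2 hAL] at hsup
    · exact absurd (eq_of_isComplement'_of_le hM hL.le
        (h.inf_eq_bot_of_sup_eq_top hc hsup hAL)) hL.ne

end IsMinimalNormal

/-- `H` and `A` are normal with trivial intersection, so they commute and `H ≤ C(A) = A`. -/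
lemma eq_bot_of_normal_le_of_isComplement' {A M : Subgroup G} [A.Normal]
    (hc : centralizer (A : Set G) = A) (hM : IsComplement' A M) {H : Subgroup G} (hn : H.Normal)
    (hHM : H ≤ M) : H = ⊥ := by
  have hinf : H ⊓ A = ⊥ := by
    rw [inf_comm, ← le_bot_iff, ← hM.disjoint.eq_bot]
    exact inf_le_inf_left A hHM
  have hHA : H ≤ A := by
    rw [← hc, ← commutator_eq_bot_iff_le_centralizer, ← le_bot_iff, ← hinf]
    exact commutator_le_inf H A
  rwa [inf_eq_left.2 hHA] at hinf

end GroupTheory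

/-! ### Existence and conjugacy of complements -/

section GroupTheory

open Subgroup

variable {G : Type*} [Group G]

/-- A normal subgroup of exponent `l`, with quotient of prime exponent `p ≠ l`, has a complement. -/
lemma exists_isComplement'_of_pow [Finite G] {A : Subgroup G} [A.Normal] {l p : ℕ}
    (hl : l.Prime) (hp : p.Prime) (hlp : p ≠ l) (hA : ∀ a ∈ A, a ^ l = 1)
    (hG : ∀ g : G, g ^ p ∈ A) : ∃ Q : Subgroup G, IsComplement' A Q := by
  have := Fact.mk hl
  have := Fact.mk hp
  have h1 : IsPGroup l A := fun a => ⟨1, Subtype.ext (by simpa using hA a a.2)⟩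
  have h2 : IsPGroup p (G ⧸ A) := fun g => ⟨1, by
    obtain ⟨g, rfl⟩ := QuotientGroup.mk_surjective g
    rw [pow_one, ← QuotientGroup.mk_pow, QuotientGroup.eq_one_iff]
    exact hG g⟩
  obtain ⟨a, ha⟩ := IsPGroup.iff_card.1 h1
  obtain ⟨b, hb⟩ := IsPGroup.iff_card.1 h2
  refine exists_right_complement'_of_coprime ?_
  rw [ha, index_eq_card, hb]
  exact Nat.Coprime.pow _ _ ((Nat.coprime_primes hl hp).2 hlp.symm)

/-- `Q` embeds in the quotient by `A`, so it is a `p`-group. A Sylow subgroup containing it still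
meets `A` trivially, as `p ≠ l`, so the modular law forces equality. -/
lemma exists_sylow_eq_of_isComplement' {A Q : Subgroup G} {l p : ℕ}
    (hl : l.Prime) (hp : p.Prime) (hlp : p ≠ l) (hA : ∀ a ∈ A, a ^ l = 1)
    (hG : ∀ g : G, g ^ p ∈ A) (hQ : IsComplement' A Q) : ∃ P : Sylow p G, (P : Subgroup G) = Q := by
  have hpQ : IsPGroup p Q := fun q => ⟨1, Subtype.ext (by
    have hm : (q : G) ^ p ∈ A ⊓ Q := ⟨hG q, Q.pow_mem q.2 p⟩
    rw [hQ.disjoint.eq_bot, mem_bot] at hm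
    simpa using hm)⟩
  obtain ⟨P, hP⟩ := hpQ.exists_le_sylow
  refine ⟨P, (eq_of_isComplement'_of_le hQ hP ?_).symm⟩
  refine (eq_bot_iff_forall _).2 fun x hx => ?_
  obtain ⟨k, hk⟩ := P.isPGroup' ⟨x, hx.2⟩
  have hk' : x ^ p ^ k = 1 := by simpa using congrArg Subtype.val hk
  have hcop : Nat.Coprime l (p ^ k) := Nat.Coprime.pow_right _ ((Nat.coprime_primes hl hp).2 hlp.symm)
  rw [← orderOf_eq_one_iff, ← Nat.dvd_one, ← hcop]
  exact Nat.dvd_gcd (orderOf_dvd_of_pow_eq_one (hA x hx.1)) (orderOf_dvd_of_pow_eq_one hk')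

variable {A : Subgroup G}

/-- If a minimal normal subgroup `A` is its own centralizer and `B` is a strictly larger normal
subgroup with `B/A` of prime exponent `p`, then `A` is not of exponent `p`. -/
lemma IsMinimalNormal.ne_of_pow_mem [Finite G] (h : IsMinimalNormal A)
    (hc : centralizer (A : Set G) = A) {B : Subgroup G} (hB : B.Normal) (hBA : ¬ B ≤ A)
    {l p : ℕ} (hp : p.Prime) (hA : ∀ a ∈ A, a ^ l = 1)
    (hBp : ∀ b ∈ B, b ^ p ∈ A) : p ≠ l := by
  rintro rfl
  have := Fact.mk hp
  have := h.normal
  have hpB : IsPGroup p B := fun b => ⟨2, Subtype.ext (by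
    have := hA _ (hBp b b.2)
    rw [← pow_mul] at this
    simpa [pow_two] using this)⟩
  have hpA : IsPGroup p A := fun a => ⟨1, Subtype.ext (by simpa using hA a a.2)⟩
  have hdvd : p ∣ Nat.card A := by
    obtain ⟨k, hk⟩ := IsPGroup.iff_card.1 hpA
    rw [hk]
    refine dvd_pow_self _ fun hk0 => h.ne_bot (A.eq_bot_of_card_eq ?_)
    rw [hk, hk0, pow_zero]
  -- If `p = l`, the `p`-group `B` acts by conjugation on the nontrivial `p`-group `A`. The fixed
  -- points are more than `{1}`, so the normal subgroup `A ⊓ C(B)` is all of `A` and `B ≤ C(A) = A`,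
  -- a contradiction.
  let _ : MulAction B A := MulAction.compHom A ((MulAut.conjNormal (H := A)).comp B.subtype)
  have hsmul (b : B) (a : A) : ((b • a : A) : G) = b * a * (b : G)⁻¹ := MulAut.conjNormal_apply _ _
  obtain ⟨a, ha, ha1⟩ := hpB.exists_fixed_point_of_prime_dvd_card_of_fixed_point A hdvd
    (a := 1) fun b => Subtype.ext (by simp [hsmul])
  have hmem : (a : G) ∈ A ⊓ centralizer (B : Set G) := ⟨a.2, fun b hb => by
    have := (hsmul ⟨b, hb⟩ a).symm.trans (congrArg Subtype.val (ha ⟨b, hb⟩))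
    exact mul_inv_eq_iff_eq_mul.1 this⟩
  rcases h.eq_bot_or_eq _ inferInstance (inf_le_left (a := A) (b := centralizer (B : Set G)))
    with hbot | hle
  · rw [hbot, mem_bot] at hmem
    exact ha1 (Subtype.ext hmem.symm)
  · refine hBA ?_
    rw [← hc, le_centralizer_iff]
    exact inf_eq_left.1 hle

lemma isComplement'_subgroupOf_of_isComplement' {M B : Subgroup G} (hM : IsComplement' A M)
    (hAB : A ≤ B) : IsComplement' (A.subgroupOf B) (M.subgroupOf B) := by
  refine isComplement'_of_disjoint_and_mul_eq_univ ?_ (Set.eq_univ_of_forall fun b => ?_)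
  · rw [disjoint_iff, ← le_bot_iff]
    intro x hx
    have hm : (x : G) ∈ A ⊓ M := hx
    rw [hM.disjoint.eq_bot, mem_bot] at hm
    exact Subtype.ext hm
  · obtain ⟨a, ha, m, hm, he⟩ := exists_mul_eq_of_isComplement' hM (b : G)
    have hmB : m ∈ B := (B.mul_mem_cancel_left (hAB ha)).1 (he ▸ b.2)
    exact ⟨⟨a, hAB ha⟩, ha, ⟨m, hmB⟩, hm, Subtype.ext he⟩

/-- The normalizer of a suitable Sylow subgroup is a complement. -/
lemma IsMinimalNormal.isComplement'_normalizer [Finite G] (h : IsMinimalNormal A)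
    (hc : centralizer (A : Set G) = A) {B : Subgroup G} [B.Normal] (hBA : ¬ B ≤ A)
    {p : ℕ} [Fact p.Prime] (P : Sylow p B) (hP : IsComplement' (A.subgroupOf B) P) :
    IsComplement' A (normalizer (((P : Subgroup B).map B.subtype : Subgroup G) : Set G)) := by
  set Q := (P : Subgroup B).map B.subtype with hQ
  have hAn := h.normal
  have hB : B ≤ A ⊔ Q := fun b hb => by
    obtain ⟨a, ha, q, hq, he⟩ := exists_mul_eq_of_isComplement' hP ⟨b, hb⟩
    have he' : (a : G) * q = b := congrArg Subtype.val he
    rw [← he']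
    exact mul_mem_sup ha (mem_map_of_mem _ hq)
  have hAQ : A ⊓ Q = ⊥ := by
    refine (eq_bot_iff_forall _).2 ?_
    rintro x ⟨hxA, y, hy, rfl⟩
    have : y ∈ A.subgroupOf B ⊓ P := ⟨hxA, hy⟩
    rw [hP.disjoint.eq_bot, mem_bot] at this
    simp [this]
  -- Frattini argument: `G = B · N(Q)`, and `B ≤ A Q`.
  have hsup : A ⊔ normalizer (Q : Set G) = ⊤ := by
    rw [eq_top_iff, ← Sylow.normalizer_sup_eq_top P, ← hQ]
    exact sup_le le_sup_right (hB.trans (sup_le_sup_left le_normalizer _))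
  refine h.isComplement'_of_sup_eq_top hc.ge hsup fun hle => hBA ?_
  -- If `A` normalized `Q`, then `[A, Q] ≤ A ⊓ Q = 1`, so `Q ≤ C(A) = A`.
  have hQA : Q ≤ A := by
    rw [← hc]
    intro q hq a ha
    have h1 : a * q * a⁻¹ * q⁻¹ ∈ A ⊓ Q := by
      refine ⟨?_, Q.mul_mem ((mem_normalizer_iff.1 (hle ha) q).1 hq) (Q.inv_mem hq)⟩
      have := A.mul_mem ha (hAn.conj_mem _ (A.inv_mem ha) q)
      simpa [mul_assoc] using this
    rw [hAQ, mem_bot] at h1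
    simpa [mul_inv_eq_iff_eq_mul] using h1
  exact hB.trans (sup_le le_rfl hQA)

/-- `B` is the preimage of a minimal normal subgroup of the solvable group `G ⧸ A`. -/
lemma IsMinimalNormal.exists_normal_pow_mem [Finite G] [Group.IsSolvable G] (h : IsMinimalNormal A)
    (hA : A ≠ ⊤) : ∃ (B : Subgroup G) (p : ℕ), p.Prime ∧ B.Normal ∧ A ≤ B ∧ ¬ B ≤ A ∧
      ∀ b ∈ B, b ^ p ∈ A := by
  have := h.normal
  have : Nontrivial (G ⧸ A) := QuotientGroup.nontrivial_iff.2 hA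
  obtain ⟨C, -, hC⟩ := exists_isMinimalNormal_le (G := G ⧸ A) (H := ⊤) inferInstance top_ne_bot
  obtain ⟨p, hp, hCp⟩ := hC.exists_prime_forall_pow_eq_one hC.le_centralizer
  have := hC.normal
  refine ⟨C.comap (QuotientGroup.mk' A), p, hp, inferInstance, fun a ha => ?_, fun hle => ?_,
    fun b hb => ?_⟩
  · rw [mem_comap, QuotientGroup.mk'_apply, (QuotientGroup.eq_one_iff a).2 ha]
    exact C.one_mem
  · refine hC.ne_bot ((eq_bot_iff_forall _).2 fun x hx => ?_)
    obtain ⟨x, rfl⟩ := QuotientGroup.mk_surjective x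
    exact (QuotientGroup.eq_one_iff x).2 (hle hx)
  · rw [← QuotientGroup.eq_one_iff, QuotientGroup.mk_pow]
    exact hCp _ hb

theorem IsMinimalNormal.exists_isComplement' [Finite G] [Group.IsSolvable G]
    (h : IsMinimalNormal A) (hc : centralizer (A : Set G) = A) :
    ∃ M : Subgroup G, IsComplement' A M := by
  by_cases hA : A = ⊤
  · exact ⟨⊥, isComplement'_bot_right.2 hA⟩
  obtain ⟨l, hl, hAl⟩ := h.exists_prime_forall_pow_eq_one hc.ge
  obtain ⟨B, p, hp, hB, hAB, hBA, hBp⟩ := h.exists_normal_pow_mem hA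
  have hpl := h.ne_of_pow_mem hc hB hBA hp hAl hBp
  have := Fact.mk hp
  have := h.normal
  have h1 : ∀ a ∈ A.subgroupOf B, a ^ l = 1 := fun a ha => Subtype.ext (hAl _ ha)
  have h2 : ∀ b : B, b ^ p ∈ A.subgroupOf B := fun b => hBp _ b.2
  obtain ⟨Q, hQ⟩ := exists_isComplement'_of_pow hl hp hpl h1 h2
  obtain ⟨P, rfl⟩ := exists_sylow_eq_of_isComplement' hl hp hpl h1 h2 hQ
  exact ⟨_, h.isComplement'_normalizer hc hBA P hQ⟩

theorem IsMinimalNormal.isConj_of_isComplement' [Finite G] [Group.IsSolvable G]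
    (h : IsMinimalNormal A) (hc : centralizer (A : Set G) = A) {M M' : Subgroup G}
    (hM : IsComplement' A M) (hM' : IsComplement' A M') :
    ∃ g : G, M.map (MulAut.conj g).toMonoidHom = M' := by
  by_cases hA : A = ⊤
  · rw [hA, isComplement'_top_left] at hM hM'
    exact ⟨1, by rw [hM, hM', Subgroup.map_bot]⟩
  obtain ⟨l, hl, hAl⟩ := h.exists_prime_forall_pow_eq_one hc.ge
  obtain ⟨B, p, hp, hB, hAB, hBA, hBp⟩ := h.exists_normal_pow_mem hA
  have hpl := h.ne_of_pow_mem hc hB hBA hp hAl hBp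
  have := Fact.mk hp
  have := h.normal
  have h1 : ∀ a ∈ A.subgroupOf B, a ^ l = 1 := fun a ha => Subtype.ext (hAl _ ha)
  have h2 : ∀ b : B, b ^ p ∈ A.subgroupOf B := fun b => hBp _ b.2
  -- A complement `L` normalizes `L ⊓ B`, which is a Sylow subgroup of `B`. Its normalizer is again
  -- a complement and contains `L`, so it equals `L`. Conjugacy then follows from Sylow's theorem in
  -- `B`.
  have key (L : Subgroup G) (hL : IsComplement' A L) : ∃ P : Sylow p B,
      normalizer (((P : Subgroup B).map B.subtype : Subgroup G) : Set G) = L := by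
    have hLB := isComplement'_subgroupOf_of_isComplement' hL hAB
    obtain ⟨P, hP⟩ := exists_sylow_eq_of_isComplement' hl hp hpl h1 h2 hLB
    rw [← hP] at hLB
    refine ⟨P, (eq_of_isComplement'_of_le hL ?_
      (h.isComplement'_normalizer hc hBA P hLB).disjoint.eq_bot).symm⟩
    rw [hP, subgroupOf_map_subtype, inf_comm]
    exact le_normalizer_inf_left L B
  obtain ⟨P, rfl⟩ := key M hM
  obtain ⟨P', rfl⟩ := key M' hM'
  obtain ⟨b, rfl⟩ := MulAction.exists_smul_eq B P P'
  refine ⟨b, ?_⟩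
  have hmap : ((b • P : Sylow p B) : Subgroup B).map B.subtype =
      ((P : Subgroup B).map B.subtype).map (MulAut.conj (b : G)).toMonoidHom := by
    rw [map_map]
    exact map_map _ _ _
  rw [hmap]
  exact map_equiv_normalizer_eq _ _

end GroupTheory

/-! ### Representations given by conjugation -/

section ConjugationRepresentation

open Subgroup

lemma le_centralizer_of_mulEquiv {G N : Type*} [Group G] [AddCommGroup N] {A : Subgroup G}
    (e : Multiplicative N ≃* A) : A ≤ centralizer (A : Set G) := by
  intro x hx y hy
  have : (⟨y, hy⟩ * ⟨x, hx⟩ : A) = ⟨x, hx⟩ * ⟨y, hy⟩ :=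
    e.symm.injective (by rw [map_mul, map_mul, mul_comm])
  exact congrArg Subtype.val this

variable {Γ G : Type*} [Group Γ] [Group G] {r : Γ →* G} {l : ℕ} [Fact l.Prime]
  {N : Type*} [AddCommGroup N] [Module (ZMod l) N] {ρ : Representation (ZMod l) Γ N}
  {A : Subgroup G} {e : Multiplicative N ≃* A}

lemma normal_of_conj (hr : Function.Surjective r)
    (he : ∀ σ y, (e (.ofAdd (ρ σ y)) : G) = r σ * e (.ofAdd y) * (r σ)⁻¹) : A.Normal := by
  refine ⟨fun a ha g => ?_⟩
  obtain ⟨σ, rfl⟩ := hr g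
  obtain ⟨y, hy⟩ := e.surjective ⟨a, ha⟩
  have := he σ y.toAdd
  rw [ofAdd_toAdd, hy] at this
  rw [← this]
  exact (e _).2

lemma isMinimalNormal_of_isIrreducible (hr : Function.Surjective r)
    (he : ∀ σ y, (e (.ofAdd (ρ σ y)) : G) = r σ * e (.ofAdd y) * (r σ)⁻¹)
    (hρ : ρ.IsIrreducible) : IsMinimalNormal A := by
  refine ⟨normal_of_conj hr he, fun hA => ?_, fun H hH hHA => ?_⟩
  · have : Subsingleton N := by
      refine ⟨fun x y => ?_⟩
      have : Subsingleton A := by rw [hA]; infer_instance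
      exact Multiplicative.ofAdd.injective (e.injective (Subsingleton.elim _ _))
    refine (bot_ne_top (α := Subrepresentation ρ)) (Subrepresentation.toSubmodule_injective ?_)
    exact Subsingleton.elim _ _
  -- Over the prime field every additive subgroup is a subspace, so normal subgroups of `G` inside
  -- `A` are subrepresentations.
  · let S : Subrepresentation ρ :=
      { toSubmodule := AddSubgroup.toZModSubmodule l
          (Subgroup.toAddSubgroup ((H.subgroupOf A).comap e.toMonoidHom))
        apply_mem_toSubmodule := fun σ y hy => by
          change (e (.ofAdd (ρ σ y)) : G) ∈ H
          rw [he]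
          exact hH.conj_mem _ hy _ }
    have hS (a : A) : (e.symm a).toAdd ∈ S.toSubmodule ↔ (a : G) ∈ H := by
      change (e (e.symm a) : G) ∈ H ↔ _
      rw [e.apply_symm_apply]
    rcases hρ.eq_bot_or_eq_top S with h | h
    · left
      refine (eq_bot_iff_forall _).2 fun x hx => ?_
      have h1 := (hS ⟨x, hHA hx⟩).2 hx
      rw [h] at h1
      have h2 : (e.symm ⟨x, hHA hx⟩).toAdd = 0 := h1
      rw [toAdd_eq_zero, map_eq_one_iff e.symm e.symm.injective] at h2
      exact congrArg Subtype.val h2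
    · right
      refine le_antisymm hHA fun x hx => (hS ⟨x, hx⟩).1 ?_
      rw [h]
      exact Submodule.mem_top

lemma isIrreducible_of_isMinimalNormal (hr : Function.Surjective r)
    (he : ∀ σ y, (e (.ofAdd (ρ σ y)) : G) = r σ * e (.ofAdd y) * (r σ)⁻¹)
    (hA : IsMinimalNormal A) : ρ.IsIrreducible := by
  have hnt : Nontrivial A := A.nontrivial_iff_ne_bot.2 hA.ne_bot
  have hNnt : Nontrivial N := by
    have := e.toEquiv.nontrivial
    exact Multiplicative.toAdd.symm.nontrivial
  refine { exists_pair_ne := ⟨⊥, ⊤, fun h => ?_⟩, eq_bot_or_eq_top := fun S => ?_ }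
  · exact (bot_ne_top (α := Submodule (ZMod l) N)) (congrArg Subrepresentation.toSubmodule h)
  · let H : Subgroup G := ((AddSubgroup.toSubgroup S.toSubmodule.toAddSubgroup).map
      e.toMonoidHom).map A.subtype
    have hH (y : N) : (e (.ofAdd y) : G) ∈ H ↔ y ∈ S.toSubmodule := by
      refine ⟨?_, fun hy => ⟨_, ⟨.ofAdd y, hy, rfl⟩, rfl⟩⟩
      rintro ⟨_, ⟨z, hz, rfl⟩, h⟩
      have : z = .ofAdd y := e.injective (Subtype.ext h)
      rw [this] at hz
      exact hz
    have hHn : H.Normal := by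
      refine ⟨?_⟩
      rintro _ ⟨_, ⟨y, hy, rfl⟩, rfl⟩ g
      obtain ⟨σ, rfl⟩ := hr g
      have := he σ y.toAdd
      rw [ofAdd_toAdd] at this
      change r σ * (e y : G) * _ ∈ H
      rw [← this, hH]
      exact S.apply_mem_toSubmodule σ hy
    rcases hA.eq_bot_or_eq H hHn (map_subtype_le _) with h | h
    · left
      refine Subrepresentation.toSubmodule_injective ((Submodule.eq_bot_iff _).2 fun y hy => ?_)
      rw [← hH, h, mem_bot] at hy
      have : e (.ofAdd y) = 1 := Subtype.ext hy
      rwa [map_eq_one_iff e e.injective, ofAdd_eq_one] at this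
    · right
      refine Subrepresentation.toSubmodule_injective (Submodule.eq_top_iff'.2 fun y => ?_)
      rw [← hH, h]
      exact (e _).2

lemma ker_asGroupHom_eq_comap_centralizer
    (he : ∀ σ y, (e (.ofAdd (ρ σ y)) : G) = r σ * e (.ofAdd y) * (r σ)⁻¹) :
    ρ.asGroupHom.ker = (centralizer (A : Set G)).comap r := by
  ext σ
  have h1 : σ ∈ ρ.asGroupHom.ker ↔ ∀ y, ρ σ y = y := by
    rw [MonoidHom.mem_ker, Units.ext_iff, Representation.asGroupHom_apply, LinearMap.ext_iff]
    rfl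
  rw [h1, mem_comap, mem_centralizer_iff]
  refine ⟨fun h a ha => ?_, fun h y => ?_⟩
  · obtain ⟨y, hy⟩ := e.surjective ⟨a, ha⟩
    have := he σ y.toAdd
    rw [h, ofAdd_toAdd, hy, eq_mul_inv_iff_mul_eq] at this
    exact this
  · refine Multiplicative.ofAdd.injective (e.injective (Subtype.ext ?_))
    rw [he, mul_inv_eq_iff_eq_mul, h _ (e _).2]

/-- `ker r` acts trivially, so `ρ` factors through `G`; this exhibits the image of `ρ` as `G /
C(A)`. -/
lemma exists_monoidHom_range_ker_eq (hr : Function.Surjective r)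
    (he : ∀ σ y, (e (.ofAdd (ρ σ y)) : G) = r σ * e (.ofAdd y) * (r σ)⁻¹) :
    ∃ g : G →* ρ.asGroupHom.range, Function.Surjective g ∧ g.ker = centralizer (A : Set G) := by
  have hker := ker_asGroupHom_eq_comap_centralizer he
  have hle : r.ker ≤ ρ.asGroupHom.rangeRestrict.ker := by
    rw [MonoidHom.ker_rangeRestrict, hker]
    intro σ hσ
    rw [mem_comap, MonoidHom.mem_ker.1 hσ]
    exact one_mem _
  let g := r.liftOfSurjective hr ⟨ρ.asGroupHom.rangeRestrict, hle⟩
  have hg (σ : Γ) : g (r σ) = ρ.asGroupHom.rangeRestrict σ :=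
    r.liftOfRightInverse_comp_apply _ _ ⟨ρ.asGroupHom.rangeRestrict, hle⟩ σ
  refine ⟨g, fun x => ?_, ?_⟩
  · obtain ⟨σ, rfl⟩ := ρ.asGroupHom.rangeRestrict_surjective x
    exact ⟨r σ, hg σ⟩
  · ext x
    obtain ⟨σ, rfl⟩ := hr x
    rw [MonoidHom.mem_ker, hg, ← MonoidHom.mem_ker, MonoidHom.ker_rangeRestrict, hker, mem_comap]

lemma exists_representation_conj [A.Normal] (r : Γ →* G) (e : Multiplicative N ≃* A) :
    ∃ ρ : Representation (ZMod l) Γ N,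
      ∀ σ y, (e (.ofAdd (ρ σ y)) : G) = r σ * e (.ofAdd y) * (r σ)⁻¹ := by
  let c (σ : Γ) : N →ₗ[ZMod l] N := AddMonoidHom.toZModLinearMap l
    (MonoidHom.toAdditive ((e.symm.toMonoidHom.comp (MulAut.conjNormal (r σ)).toMonoidHom).comp
      e.toMonoidHom))
  have hc (σ : Γ) (y : N) : e (.ofAdd (c σ y)) = MulAut.conjNormal (r σ) (e (.ofAdd y)) := by
    change e (e.symm _) = _
    rw [e.apply_symm_apply]
    rfl
  have hinj {x y : N} (h : e (.ofAdd x) = e (.ofAdd y)) : x = y :=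
    Multiplicative.ofAdd.injective (e.injective h)
  refine ⟨{ toFun := c, map_one' := ?_, map_mul' := fun σ τ => ?_ }, fun σ y => ?_⟩
  · ext y
    exact hinj (by rw [hc, map_one, map_one]; rfl)
  · ext y
    refine hinj ?_
    rw [hc, map_mul, map_mul, MulAut.mul_apply, Module.End.mul_apply, hc, hc]
  · exact (congrArg Subtype.val (hc σ y)).trans (MulAut.conjNormal_apply _ _)

lemma nonempty_equiv_of_conj {N' : Type*} [AddCommGroup N'] [Module (ZMod l) N']
    {ρ' : Representation (ZMod l) Γ N'} {e' : Multiplicative N' ≃* A}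
    (he : ∀ σ y, (e (.ofAdd (ρ σ y)) : G) = r σ * e (.ofAdd y) * (r σ)⁻¹)
    (he' : ∀ σ y, (e' (.ofAdd (ρ' σ y)) : G) = r σ * e' (.ofAdd y) * (r σ)⁻¹) :
    Nonempty (ρ.Equiv ρ') := by
  let f : N ≃+ N' := MulEquiv.toAdditive (e.trans e'.symm)
  have hf (y : N) : e' (.ofAdd (f y)) = e (.ofAdd y) := e'.apply_symm_apply _
  let f' : N ≃ₗ[ZMod l] N' :=
    { f with map_smul' := fun c x => (AddMonoidHom.toZModLinearMap l f.toAddMonoidHom).map_smul c x }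
  refine ⟨.mk f' fun σ => LinearMap.ext fun y => ?_⟩
  refine Multiplicative.ofAdd.injective (e'.injective (Subtype.ext ?_))
  change (e' (.ofAdd (f (ρ σ y))) : G) = e' (.ofAdd (ρ' σ (f y)))
  rw [hf, he, he', hf]

lemma finrank_eq_of_card {n : ℕ} (e : Multiplicative N ≃* A)
    (hA : Nat.card A = l ^ n) : Module.finrank (ZMod l) N = n := by
  have hl := (Fact.out : l.Prime)
  have hc : Nat.card N = l ^ n := (Nat.card_congr (Multiplicative.ofAdd.trans e.toEquiv)).trans hA
  have : Finite N := Nat.finite_of_card_ne_zero (by rw [hc]; exact pow_ne_zero _ hl.ne_zero)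
  have h := Module.natCard_eq_pow_finrank (K := ZMod l) (V := N)
  rw [hc, Nat.card_zmod] at h
  exact (Nat.pow_right_injective hl.two_le h).symm

lemma nonempty_pi_mulEquiv_of_card {n : ℕ} (e : Multiplicative N ≃* A)
    (hA : Nat.card A = l ^ n) : Nonempty (Multiplicative (Fin n → ZMod l) ≃* A) := by
  have hl := (Fact.out : l.Prime)
  have hc : Nat.card N = l ^ n := (Nat.card_congr (Multiplicative.ofAdd.trans e.toEquiv)).trans hA
  have : Finite N := Nat.finite_of_card_ne_zero (by rw [hc]; exact pow_ne_zero _ hl.ne_zero)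
  have f : (Fin n → ZMod l) ≃ₗ[ZMod l] N := LinearEquiv.ofFinrankEq _ _
    (by rw [finrank_eq_of_card e hA, Module.finrank_fin_fun])
  exact ⟨(AddEquiv.toMultiplicative f.toAddEquiv).trans e⟩

lemma IsMinimalNormal.exists_mulEquiv [Finite G] (h : IsMinimalNormal A)
    (hc : A ≤ centralizer (A : Set G)) {n : ℕ} (hn : 0 < n) (hA : Nat.card A = l ^ n) :
    Nonempty (Multiplicative (Fin n → ZMod l) ≃* A) := by
  have hl := (Fact.out : l.Prime)
  obtain ⟨p, hp, hpA⟩ := h.exists_prime_forall_pow_eq_one hc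
  -- As `n > 0`, `l` divides `|A|`, which is a power of `p`.
  have hpl : p = l := by
    have := Fact.mk hp
    have h1 : IsPGroup p A := fun a => ⟨1, Subtype.ext (by simpa using hpA a a.2)⟩
    obtain ⟨k, hk⟩ := IsPGroup.iff_card.1 h1
    have hdvd : l ∣ p ^ k := by rw [← hk, hA]; exact dvd_pow_self _ hn.ne'
    exact ((Nat.prime_dvd_prime_iff_eq hl hp).1 (hl.dvd_of_dvd_pow hdvd)).symm
  subst hpl
  let _ : CommGroup A :=
    { (inferInstance : Group A) with
      mul_comm := fun a b => Subtype.ext (hc b.2 a a.2) }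
  let _ : Module (ZMod p) (Additive A) := AddCommGroup.zmodModule fun x =>
    Subtype.ext (hpA _ x.toMul.2)
  have e : Multiplicative (Additive A) ≃* A :=
    { Multiplicative.toAdd.trans Additive.toMul with map_mul' := fun _ _ => rfl }
  exact nonempty_pi_mulEquiv_of_card e hA

end ConjugationRepresentation

/-! ### Primitive extensions and core-free maximal subgroups of Galois groups -/

section Galois

open IntermediateField

lemma IsPrimitiveExtension.congr {F E E' : Type*} [Field F] [Field E] [Algebra F E] [Field E']
    [Algebra F E'] (f : E ≃ₐ[F] E') (h : IsPrimitiveExtension F E) : IsPrimitiveExtension F E' where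
  finiteDimensional := have := h.finiteDimensional; f.toLinearEquiv.finiteDimensional
  isSeparable := have := h.isSeparable; .of_algHom F E f.symm.toAlgHom
  one_lt_finrank := f.toLinearEquiv.finrank_eq ▸ h.one_lt_finrank
  eq_bot_or_eq_top L := by
    have hL : (L.comap f.toAlgHom).map f.toAlgHom = L := by
      ext x
      refine ⟨?_, fun hx => ⟨f.symm x, ?_, f.apply_symm_apply x⟩⟩
      · rintro ⟨y, hy, rfl⟩
        exact hy
      · change f (f.symm x) ∈ L
        rwa [f.apply_symm_apply]
    rcases h.eq_bot_or_eq_top (L.comap f.toAlgHom) with h | h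
    · left
      rw [← hL, h, IntermediateField.map_bot]
    · right
      rw [← hL, h, ← AlgHom.fieldRange_eq_map, AlgHom.fieldRange_eq_top]
      exact f.surjective

variable {F : Type*} [Field F] {Ft : Type*} [Field Ft] [Algebra F Ft]

lemma normalClosure_le_of_algEquiv {E E' : Type*} [Field E] [Algebra F E] [Field E'] [Algebra F E']
    (f : E ≃ₐ[F] E') :
    IntermediateField.normalClosure F E Ft ≤ IntermediateField.normalClosure F E' Ft := by
  rw [normalClosure_def, iSup_le_iff]
  intro g
  refine le_trans ?_ (AlgHom.fieldRange_le_normalClosure (g.comp f.symm.toAlgHom))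
  rintro _ ⟨x, rfl⟩
  exact ⟨f x, congrArg g (f.symm_apply_apply x)⟩

lemma normalClosure_congr {E E' : Type*} [Field E] [Algebra F E] [Field E'] [Algebra F E']
    (f : E ≃ₐ[F] E') :
    IntermediateField.normalClosure F E Ft = IntermediateField.normalClosure F E' Ft :=
  le_antisymm (normalClosure_le_of_algEquiv f) (normalClosure_le_of_algEquiv f.symm)

lemma IsSolvablePrimitive.congr {E E' : Type*} [Field E] [Algebra F E] [Field E'] [Algebra F E']
    (f : E ≃ₐ[F] E') (h : IsSolvablePrimitive F Ft E) : IsSolvablePrimitive F Ft E' where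
  isPrimitive := h.isPrimitive.congr f
  isSolvable := normalClosure_congr (Ft := Ft) f ▸ h.isSolvable

lemma isPrimitiveExtension_iff_isAtom {D : Type*} [Field D] [Algebra F D] [FiniteDimensional F D]
    [IsGalois F D] (E : IntermediateField F D) : IsPrimitiveExtension F E ↔ IsAtom E := by
  constructor
  · intro h
    refine ⟨fun hE => ?_, fun L hL => ?_⟩
    · have := h.one_lt_finrank
      rw [hE, IntermediateField.finrank_bot] at this
      exact lt_irrefl _ this
    · rw [← lift_restrict hL.le]
      rcases h.eq_bot_or_eq_top (restrict hL.le) with h | h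
      · rw [h, lift_bot]
      · refine absurd ?_ hL.ne
        rw [← lift_restrict hL.le, h, lift_top]
  · intro h
    refine ⟨inferInstance, inferInstance, ?_, fun L => ?_⟩
    · refine lt_of_le_of_ne Module.finrank_pos fun h1 => h.1 ?_
      exact IntermediateField.finrank_eq_one_iff.1 h1.symm
    · rcases h.le_iff.1 (lift_le L) with h | h
      · left
        exact lift_injective E (by rw [h, lift_bot])
      · right
        exact lift_injective E (by rw [h, lift_top])

lemma isAtom_iff_isCoatom_fixingSubgroup {D : Type*} [Field D] [Algebra F D]
    [FiniteDimensional F D] [IsGalois F D] (E : IntermediateField F D) :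
    IsAtom E ↔ IsCoatom E.fixingSubgroup := by
  rw [← IsGalois.intermediateFieldEquivSubgroup.isAtom_iff, ← isCoatom_dual_iff_isAtom]
  rfl

lemma eq_top_iff_fixingSubgroup_eq_bot {D : Type*} [Field D] [Algebra F D]
    [FiniteDimensional F D] [IsGalois F D] (E : IntermediateField F D) :
    E = ⊤ ↔ E.fixingSubgroup = ⊥ := by
  refine ⟨fun h => by rw [h, fixingSubgroup_top], fun h => ?_⟩
  rw [← IsGalois.fixedField_fixingSubgroup E, h, fixedField_bot]

lemma lift_le_lift_iff {D : IntermediateField F Ft} {E L : IntermediateField F D} :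
    lift E ≤ lift L ↔ E ≤ L :=
  ⟨fun h x hx => (mem_lift x).1 (h ((mem_lift x).2 hx)), fun h x hx =>
    (mem_lift ⟨x, lift_le E hx⟩).2 (h ((mem_lift ⟨x, lift_le E hx⟩).1 hx))⟩

/-- The Galois closure of `E ⊆ D` is `D` if and only if `Gal(D|E)` is core-free. -/
lemma normalClosure_eq_iff_coreFree [IsGalois F Ft] {D : IntermediateField F Ft}
    [FiniteDimensional F D] [IsGalois F D] (E : IntermediateField F D) :
    IntermediateField.normalClosure F E Ft = D ↔
      ∀ H : Subgroup Gal(D/F), H.Normal → H ≤ E.fixingSubgroup → H = ⊥ := by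
  rw [normalClosure_congr (Ft := Ft) (liftAlgEquiv E)]
  constructor
  · intro h H hH hHE
    have hEH := lift_le_lift_iff.2 ((IntermediateField.le_iff_le _ _).2 hHE)
    -- The fixed field of a normal `H` is Galois over `F`; if it contains `E`, it contains the
    -- closure `D`.
    have : IsGalois F (lift (fixedField H)) := IsGalois.of_algEquiv (liftAlgEquiv (fixedField H))
    rw [← normalClosure_le_iff_of_normal, h] at hEH
    have htop : fixedField H = ⊤ := by
      rw [eq_top_iff, ← lift_le_lift_iff, lift_top]
      exact hEH
    rwa [eq_top_iff_fixingSubgroup_eq_bot, fixingSubgroup_fixedField] at htop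
  · intro h
    have hle : IntermediateField.normalClosure F (lift E) Ft ≤ D := by
      rw [normalClosure_le_iff_of_normal]
      exact lift_le E
    refine le_antisymm hle ?_
    have : IsGalois F (restrict hle) := IsGalois.of_algEquiv (restrictAlgEquiv hle)
    have hER : E ≤ restrict hle := by
      refine lift_le_lift_iff.1 ?_
      rw [lift_restrict]
      exact le_normalClosure _
    have := (eq_top_iff_fixingSubgroup_eq_bot _).2
      (h (restrict hle).fixingSubgroup inferInstance (fixingSubgroup_le hER))
    rw [← lift_restrict hle, this, lift_top]

end Galois

/-! ### From pairs to extensions and back -/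

section Galois

open IntermediateField

variable {F : Type*} [Field F] {Ft : Type*} [Field Ft] [Algebra F Ft]

lemma isSolvablePrimitive_and_normalClosure_eq_iff [IsGalois F Ft] {D : IntermediateField F Ft}
    [FiniteDimensional F D] [IsGalois F D] (hs : Group.IsSolvable Gal(D/F))
    (E : IntermediateField F D) :
    (IsSolvablePrimitive F Ft E ∧ IntermediateField.normalClosure F E Ft = D) ↔
      (IsCoatom E.fixingSubgroup ∧
        ∀ H : Subgroup Gal(D/F), H.Normal → H ≤ E.fixingSubgroup → H = ⊥) := by
  rw [← normalClosure_eq_iff_coreFree, ← isAtom_iff_isCoatom_fixingSubgroup,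
    ← isPrimitiveExtension_iff_isAtom]
  refine ⟨fun h => ⟨h.1.isPrimitive, h.2⟩, fun h => ⟨⟨h.1, ?_⟩, h.2⟩⟩
  rw [h.2]
  exact hs

/-- Replaces an abstract `E` by a subfield of its closure, where the Galois correspondence applies.
-/
lemma exists_algEquiv_intermediateField_normalClosure [IsSepClosure F Ft] (E : Type*) [Field E]
    [Algebra F E] [Algebra.IsSeparable F E] :
    ∃ E' : IntermediateField F (IntermediateField.normalClosure F E Ft), Nonempty (E ≃ₐ[F] E') := by
  have := IsSepClosure.sep_closed (k := F) (K := Ft)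
  let f : E →ₐ[F] Ft := IsSepClosed.lift
  have hle := f.fieldRange_le_normalClosure
  exact ⟨restrict hle, ⟨(AlgEquiv.ofInjectiveField f).trans (restrictAlgEquiv hle)⟩⟩

lemma exists_algEquiv_isCoatom [IsSepClosure F Ft] {E : Type*} [Field E] [Algebra F E]
    (hE : IsSolvablePrimitive F Ft E) {D : IntermediateField F Ft}
    (hD : IntermediateField.normalClosure F E Ft = D) :
    FiniteDimensional F D ∧ IsGalois F D ∧ Group.IsSolvable Gal(D/F) ∧
      ∃ E' : IntermediateField F D, Nonempty (E ≃ₐ[F] E') ∧ IsCoatom E'.fixingSubgroup ∧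
        ∀ H : Subgroup Gal(D/F), H.Normal → H ≤ E'.fixingSubgroup → H = ⊥ := by
  subst hD
  have := hE.isPrimitive.finiteDimensional
  have := hE.isPrimitive.isSeparable
  obtain ⟨E', ⟨f⟩⟩ := exists_algEquiv_intermediateField_normalClosure (F := F) (Ft := Ft) E
  have hfd : FiniteDimensional F (IntermediateField.normalClosure F E Ft) :=
    normalClosure.is_finiteDimensional F E Ft
  have hg : IsGalois F (IntermediateField.normalClosure F E Ft) := IsGalois.normalClosure F E Ft
  exact ⟨hfd, hg, hE.isSolvable, E', ⟨f⟩, (isSolvablePrimitive_and_normalClosure_eq_iff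
    hE.isSolvable E').1 ⟨hE.congr f, (normalClosure_congr f).symm⟩⟩

lemma nonempty_algEquiv_of_map_conj {D : Type*} [Field D] [Algebra F D] [FiniteDimensional F D]
    [IsGalois F D] {E E' : IntermediateField F D} {g : Gal(D/F)}
    (h : E.fixingSubgroup.map (MulAut.conj g).toMonoidHom = E'.fixingSubgroup) :
    Nonempty (E ≃ₐ[F] E') := by
  have h1 : E.map (g : D →ₐ[F] D) = E' := by
    rw [← IsGalois.fixedField_fixingSubgroup E', ← h,
      ← IsGalois.fixedField_fixingSubgroup (E.map (g : D →ₐ[F] D)), IsGalois.map_fixingSubgroup]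
    rfl
  exact ⟨(equivMap E (g : D →ₐ[F] D)).trans (equivOfEq h1)⟩

/-- A core-free maximal subgroup of a finite solvable group gives a self-centralizing minimal normal
subgroup, which it complements. -/
lemma exists_isMinimalNormal_of_isCoatom {G : Type*} [Group G] [Finite G] [Group.IsSolvable G]
    {M : Subgroup G} (hM : IsCoatom M) (hcore : ∀ H : Subgroup G, H.Normal → H ≤ M → H = ⊥) :
    ∃ A : Subgroup G, IsMinimalNormal A ∧ Subgroup.centralizer (A : Set G) = A ∧
      Subgroup.IsComplement' A M := by
  have hne : (⊤ : Subgroup G) ≠ ⊥ := fun h => hM.1 (eq_top_iff.2 (h.le.trans bot_le))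
  obtain ⟨A, -, hA⟩ := exists_isMinimalNormal_le inferInstance hne
  have := hA.normal
  have hc := hA.isComplement'_of_isCoatom hM hcore
  exact ⟨A, hA, centralizer_eq_of_coreFree_isComplement' hA.le_centralizer hc hcore, hc⟩

/-- Both extensions correspond to complements of the same minimal normal subgroup of `Gal(D|F)`, and
these are conjugate. -/
theorem nonempty_algEquiv_of_normalClosure_eq [IsSepClosure F Ft] {E E' : Type*} [Field E]
    [Algebra F E] [Field E'] [Algebra F E'] (hE : IsSolvablePrimitive F Ft E)
    (hE' : IsSolvablePrimitive F Ft E')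
    (h : IntermediateField.normalClosure F E Ft = IntermediateField.normalClosure F E' Ft) :
    Nonempty (E ≃ₐ[F] E') := by
  obtain ⟨_, _, _, E₁, ⟨f₁⟩, hM₁, hcore₁⟩ := exists_algEquiv_isCoatom hE h
  obtain ⟨_, _, _, E₂, ⟨f₂⟩, hM₂, hcore₂⟩ := exists_algEquiv_isCoatom hE' rfl
  obtain ⟨A, hA, hAc, h₁⟩ := exists_isMinimalNormal_of_isCoatom hM₁ hcore₁
  obtain ⟨g, hg⟩ := hA.isConj_of_isComplement' hAc h₁ (hA.isComplement'_of_isCoatom hM₂ hcore₂)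
  obtain ⟨f⟩ := nonempty_algEquiv_of_map_conj hg
  exact ⟨(f₁.trans f).trans f₂.symm⟩

/-- Lets subgroups of `Gal(D|F)` be compared through their preimages in `Gal(Ft|F)`. -/
lemma comap_relGal [IsGalois F Ft] {K D : IntermediateField F Ft} [Normal F D] (h : K ≤ D) :
    (relGal h).comap (AlgEquiv.restrictNormalHom D) = K.fixingSubgroup := by
  rw [relGal, ← IntermediateField.map_fixingSubgroup]
  exact congrArg _ (lift_restrict h)

variable {l : ℕ} [Fact l.Prime] {N : Type*} [AddCommGroup N] [Module (ZMod l) N] {n : ℕ}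

lemma fixingSubgroup_kerField [IsGalois F Ft] {ρ : Representation (ZMod l) Gal(Ft/F) N}
    (h : IsOpen (ρ.asGroupHom.ker : Set Gal(Ft/F))) :
    (kerField ρ).fixingSubgroup = ρ.asGroupHom.ker :=
  InfiniteGalois.fixingSubgroup_fixedField
    ⟨ρ.asGroupHom.ker, Subgroup.isClosed_of_isOpen _ h⟩

lemma restrictNormalHom_surjective [IsGalois F Ft] (D : IntermediateField F Ft) [Normal F D] :
    Function.Surjective (AlgEquiv.restrictNormalHom D : Gal(Ft/F) →* Gal(D/F)) :=
  AlgEquiv.restrictNormalHom_surjective Ft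

/-- `Gal(D|K)` is its own centralizer. -/
lemma IsParameter.centralizer_eq [IsGalois F Ft] {ρ : Representation (ZMod l) Gal(Ft/F) N}
    {D : IntermediateField F Ft} (h : IsParameter n ρ D) :
    Subgroup.centralizer (relGal h.le : Set Gal(D/F)) = relGal h.le := by
  have := h.isGalois
  obtain ⟨e, he⟩ := h.conj
  refine Subgroup.comap_injective (restrictNormalHom_surjective D) ?_
  rw [comap_relGal, fixingSubgroup_kerField h.isOpen_ker, ker_asGroupHom_eq_comap_centralizer he]

lemma IsParameter.isMinimalNormal [IsGalois F Ft] {ρ : Representation (ZMod l) Gal(Ft/F) N}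
    {D : IntermediateField F Ft} (h : IsParameter n ρ D) : IsMinimalNormal (relGal h.le) := by
  have := h.isGalois
  obtain ⟨e, he⟩ := h.conj
  exact isMinimalNormal_of_isIrreducible (restrictNormalHom_surjective D) he h.irreducible

/-- `Gal(D|F)` is an extension of the solvable image of `ρ` by the abelian group `Gal(D|K)`. -/
lemma IsParameter.isSolvable [IsGalois F Ft] {ρ : Representation (ZMod l) Gal(Ft/F) N}
    {D : IntermediateField F Ft} (h : IsParameter n ρ D) : Group.IsSolvable Gal(D/F) := by
  have := h.isGalois
  obtain ⟨e, he⟩ := h.conj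
  obtain ⟨g, -, hg⟩ := exists_monoidHom_range_ker_eq (restrictNormalHom_surjective D) he
  have := h.solvable_image
  have : Group.IsSolvable (relGal h.le) :=
    Group.isSolvable_of_surjective (f := e.toMonoidHom) e.surjective
  refine Group.isSolvable_of_ker_le_range (relGal h.le).subtype g ?_
  rw [hg, h.centralizer_eq, Subgroup.range_subtype]

lemma IsParameter.card_relGal [IsGalois F Ft] {ρ : Representation (ZMod l) Gal(Ft/F) N}
    {D : IntermediateField F Ft} (hn : 0 < n) (h : IsParameter n ρ D) :
    Nat.card (relGal h.le) = l ^ n := by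
  have := h.isGalois
  obtain ⟨e, he⟩ := h.conj
  have : Module.Finite (ZMod l) N := Module.finite_of_finrank_pos (by rwa [h.finrank_eq])
  rw [← Nat.card_congr (Multiplicative.ofAdd.trans e.toEquiv),
    Module.natCard_eq_pow_finrank (K := ZMod l), h.finrank_eq, Nat.card_zmod]

lemma IsParameter.finiteDimensional [IsGalois F Ft] {ρ : Representation (ZMod l) Gal(Ft/F) N}
    {D : IntermediateField F Ft} (hn : 0 < n) (h : IsParameter n ρ D) : FiniteDimensional F D := by
  have := h.isGalois
  -- `Module.finrank` is `0` on infinite-dimensional spaces, so `n > 0` is what makes `N` finite.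
  -- Then `Gal(D|K)` and its index, the order of the image of `ρ`, are finite.
  have : Module.Finite (ZMod l) N := Module.finite_of_finrank_pos (by rwa [h.finrank_eq])
  have : Finite N := Module.finite_of_finite (ZMod l)
  have : Finite (N →ₗ[ZMod l] N) := DFunLike.finite _
  have : Finite Gal(D/F) := by
    refine Nat.finite_of_card_ne_zero ?_
    rw [← (relGal h.le).card_mul_index, h.card_relGal hn,
      ← (relGal h.le).index_comap_of_surjective (restrictNormalHom_surjective D), comap_relGal,
      fixingSubgroup_kerField h.isOpen_ker, Subgroup.index_ker]
    exact mul_ne_zero (pow_ne_zero _ (Fact.out : l.Prime).ne_zero) Nat.card_pos.ne'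
  exact IsGalois.finiteDimensional_of_finite F D

lemma IsParameter.isAttached [IsGalois F Ft] {ρ : Representation (ZMod l) Gal(Ft/F) N}
    {D : IntermediateField F Ft} (h : IsParameter n ρ D) {E : Type*} [Field E] [Algebra F E]
    (hD : IntermediateField.normalClosure F E Ft = D) : IsAttached E ρ D := by
  subst hD
  exact ⟨rfl, relGal h.le, h.isMinimalNormal, h.conj⟩

/-- `E` is the fixed field of a complement of `Gal(D|K)`; its degree is the index of that
complement, `|Gal(D|K)|`. -/
theorem IsParameter.exists_isAttached [IsSepClosure F Ft]
    {ρ : Representation (ZMod l) Gal(Ft/F) N} {D : IntermediateField F Ft} (hn : 0 < n)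
    (h : IsParameter n ρ D) : ∃ E : IntermediateField F Ft,
      IsSolvablePrimitive F Ft E ∧ Module.finrank F E = l ^ n ∧ IsAttached E ρ D := by
  have := h.isGalois
  have := h.finiteDimensional hn
  have hs := h.isSolvable
  obtain ⟨M, hM⟩ := h.isMinimalNormal.exists_isComplement' h.centralizer_eq
  have := h.isMinimalNormal.normal
  have hfix : (fixedField M).fixingSubgroup = M := fixingSubgroup_fixedField M
  obtain ⟨hE, hcl⟩ := (isSolvablePrimitive_and_normalClosure_eq_iff hs (fixedField M)).2 <| by
    rw [hfix]
    exact ⟨h.isMinimalNormal.isCoatom_of_isComplement' h.centralizer_eq.ge hM, fun H hH hHM =>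
      eq_bot_of_normal_le_of_isComplement' h.centralizer_eq hM hH hHM⟩
  refine ⟨lift (fixedField M), hE.congr (liftAlgEquiv _), ?_, h.isAttached ?_⟩
  · rw [← (liftAlgEquiv (fixedField M)).toLinearEquiv.finrank_eq,
      IntermediateField.finrank_eq_fixingSubgroup_index, hfix, hM.index_eq_card, h.card_relGal hn]
  · rw [← normalClosure_congr (liftAlgEquiv (fixedField M)), hcl]

theorem IsAttached.isParameter [IsSepClosure F Ft] {E : Type*} [Field E] [Algebra F E]
    (hE : IsSolvablePrimitive F Ft E) (hEn : Module.finrank F E = l ^ n)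
    {ρ : Representation (ZMod l) Gal(Ft/F) N} {D : IntermediateField F Ft}
    (h : IsAttached E ρ D) : IsParameter n ρ D := by
  obtain ⟨rfl, h⟩ := h
  set D := IntermediateField.normalClosure F E Ft with hD
  obtain ⟨A, hA, e, he⟩ := h
  obtain ⟨_, _, _, E', ⟨f⟩, hM, hcore⟩ := exists_algEquiv_isCoatom hE hD.symm
  have hAM := hA.isComplement'_of_isCoatom hM hcore
  have := hA.normal
  have hAc := centralizer_eq_of_coreFree_isComplement' hA.le_centralizer hAM hcore
  have hr := restrictNormalHom_surjective D
  have hcard : Nat.card A = l ^ n := by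
    rw [← hAM.index_eq_card, ← IntermediateField.finrank_eq_fixingSubgroup_index,
      ← f.toLinearEquiv.finrank_eq, hEn]
  have hker : ρ.asGroupHom.ker = A.comap (AlgEquiv.restrictNormalHom D) := by
    rw [ker_asGroupHom_eq_comap_centralizer he, hAc]
  have hDker : D.fixingSubgroup ≤ ρ.asGroupHom.ker := by
    rw [hker, ← IntermediateField.restrictNormalHom_ker]
    exact Subgroup.comap_mono (f := AlgEquiv.restrictNormalHom D) bot_le
  have hopen : IsOpen (ρ.asGroupHom.ker : Set Gal(Ft/F)) :=
    Subgroup.isOpen_mono hDker D.fixingSubgroup_isOpen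
  have hle : kerField ρ ≤ D := by
    rw [← InfiniteGalois.fixedField_fixingSubgroup D]
    exact fixedField_le hDker
  -- Both have preimage `ker ρ` in `Gal(Ft|F)`, because `C(A) = A`.
  have hrel : relGal hle = A := by
    refine Subgroup.comap_injective hr ?_
    rw [comap_relGal, fixingSubgroup_kerField hopen, hker]
  obtain ⟨g, hg, -⟩ := exists_monoidHom_range_ker_eq hr he
  exact
    { finrank_eq := finrank_eq_of_card e hcard
      isOpen_ker := hopen
      irreducible := isIrreducible_of_isMinimalNormal hr he hA
      solvable_image := Group.isSolvable_of_surjective hg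
      isGalois := inferInstance
      le := hle
      conj := by
        rw [hrel]
        exact ⟨e, he⟩ }

theorem exists_param_isAttached [IsSepClosure F Ft] {E : Type*} [Field E] [Algebra F E]
    (hE : IsSolvablePrimitive F Ft E) (hn : 0 < n) (hEn : Module.finrank F E = l ^ n) :
    ∃ p : Param l n F Ft, IsAttached E p.ρ p.D := by
  obtain ⟨_, _, _, E', ⟨f⟩, hM, hcore⟩ := exists_algEquiv_isCoatom hE rfl
  obtain ⟨A, hA, hAc, hAM⟩ := exists_isMinimalNormal_of_isCoatom hM hcore
  have := hA.normal
  have hcard : Nat.card A = l ^ n := by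
    rw [← hAM.index_eq_card, ← IntermediateField.finrank_eq_fixingSubgroup_index,
      ← f.toLinearEquiv.finrank_eq, hEn]
  obtain ⟨e⟩ := hA.exists_mulEquiv hAc.ge hn hcard
  obtain ⟨ρ, hρ⟩ := exists_representation_conj (l := l)
    (AlgEquiv.restrictNormalHom (IntermediateField.normalClosure F E Ft) : Gal(Ft/F) →* _) e
  have h : IsAttached E ρ (IntermediateField.normalClosure F E Ft) := ⟨rfl, A, hA, e, hρ⟩
  exact ⟨⟨ρ, _, h.isParameter hE hEn⟩, h⟩

/-- `Gal(D|F)` has a unique minimal normal subgroup, so both representations are conjugation on the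
same group. -/
lemma IsParameter.nonempty_equiv [IsGalois F Ft] {N' : Type*} [AddCommGroup N']
    [Module (ZMod l) N'] {ρ : Representation (ZMod l) Gal(Ft/F) N}
    {ρ' : Representation (ZMod l) Gal(Ft/F) N'} {D : IntermediateField F Ft}
    (h : IsParameter n ρ D) (h' : IsParameter n ρ' D) : Nonempty (ρ.Equiv ρ') := by
  have := h.isGalois
  have := h.isSolvable
  have hA : relGal h'.le = relGal h.le :=
    (h.isMinimalNormal.eq_of_centralizer_eq h.centralizer_eq h'.isMinimalNormal).symm
  obtain ⟨e, he⟩ := h.conj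
  obtain ⟨e', he'⟩ : ∃ e' : Multiplicative N' ≃* relGal h.le, ConjugationGivenBy ρ' e' :=
    hA ▸ h'.conj
  exact nonempty_equiv_of_conj he he'

end Galois

/-! ### The semidirect product decomposition -/

section Galois

open IntermediateField

variable {F : Type*} [Field F] {Ft : Type*} [Field Ft] [Algebra F Ft]
variable {l : ℕ} [Fact l.Prime] {N : Type*} [AddCommGroup N] [Module (ZMod l) N] {n : ℕ}

theorem IsParameter.exists_semidirectProduct_mulEquiv [IsGalois F Ft]
    {ρ : Representation (ZMod l) Gal(Ft/F) N} {D : IntermediateField F Ft} (hn : 0 < n)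
    (h : IsParameter n ρ D) [IsGalois F D] (e : Multiplicative N ≃* relGal h.le)
    (he : ConjugationGivenBy ρ e) :
    ∃ φ : Gal(kerField ρ/F) →* MulAut (relGal h.le),
      (∀ (σ : Gal(Ft/F)) (z : N),
        φ (AlgEquiv.restrictNormalHom (kerField ρ) σ) (e (Multiplicative.ofAdd z)) =
          e (Multiplicative.ofAdd (ρ σ z))) ∧
      ∃ Ψ : relGal h.le ⋊[φ] Gal(kerField ρ/F) ≃* Gal(D/F),
        (∀ τ : relGal h.le, Ψ (SemidirectProduct.inl τ) = (τ : Gal(D/F))) ∧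
        (∀ g (z : kerField ρ), Ψ g (inclusion h.le z) = inclusion h.le (g.right z)) := by
  have := h.finiteDimensional hn
  have := h.isSolvable
  have := h.isMinimalNormal.normal
  obtain ⟨M, hM⟩ := h.isMinimalNormal.exists_isComplement' h.centralizer_eq
  set r : Gal(Ft/F) →* Gal(D/F) := AlgEquiv.restrictNormalHom D with hr_def
  set rK : Gal(Ft/F) →* Gal(kerField ρ/F) := AlgEquiv.restrictNormalHom (kerField ρ) with hrK_def
  have hr : Function.Surjective r := restrictNormalHom_surjective D
  have hrK : Function.Surjective rK := restrictNormalHom_surjective (kerField ρ)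
  have hkerK : rK.ker = (relGal h.le).comap r := by
    rw [comap_relGal, hrK_def, restrictNormalHom_ker]
  have hle : r.ker ≤ rK.ker := by
    rw [hkerK]
    exact Subgroup.comap_mono (f := r) bot_le
  -- `q` is restriction to `K`, with kernel `Gal(D|K)`; it is bijective on the complement `M`, whose
  -- inverse gives the section `s`.
  let q : Gal(D/F) →* Gal(kerField ρ/F) := r.liftOfSurjective hr ⟨rK, hle⟩
  have hq (σ) : q (r σ) = rK σ := r.liftOfRightInverse_comp_apply _ _ ⟨rK, hle⟩ σ
  have hqker : q.ker = relGal h.le := by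
    refine Subgroup.comap_injective hr ?_
    rw [← hkerK]
    ext σ
    rw [Subgroup.mem_comap, MonoidHom.mem_ker, hq, MonoidHom.mem_ker]
  have hq_incl (g : Gal(D/F)) (z : kerField ρ) :
      g (inclusion h.le z) = inclusion h.le (q g z) := by
    obtain ⟨σ, rfl⟩ := hr g
    rw [hq]
    refine Subtype.ext ?_
    exact (AlgEquiv.restrictNormal_commutes σ D (inclusion h.le z)).trans
      (AlgEquiv.restrictNormal_commutes σ (kerField ρ) z).symm
  have hqM : Function.Bijective (q.comp M.subtype) := by
    refine ⟨(injective_iff_map_eq_one _).2 fun m hm => ?_, fun k => ?_⟩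
    · have : (m : Gal(D/F)) ∈ relGal h.le ⊓ M := ⟨hqker ▸ hm, m.2⟩
      rw [hM.disjoint.eq_bot] at this
      exact Subtype.ext this
    · obtain ⟨σ, rfl⟩ := hrK k
      obtain ⟨a, ha, m, hm, hg⟩ := exists_mul_eq_of_isComplement' hM (r σ)
      refine ⟨⟨m, hm⟩, ?_⟩
      rw [← hqker] at ha
      rw [← hq, ← hg, map_mul, MonoidHom.mem_ker.1 ha, one_mul]
      rfl
  let s : Gal(kerField ρ/F) →* Gal(D/F) :=
    M.subtype.comp (MulEquiv.ofBijective _ hqM).symm.toMonoidHom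
  have hqs (k) : q (s k) = k := (MulEquiv.ofBijective _ hqM).apply_symm_apply k
  -- `Gal(D|K)` is abelian, so its conjugation action on itself is trivial and the action of
  -- `Gal(D|F)` descends to `Gal(K|F)`.
  have hconj : rK.ker ≤ ((MulAut.conjNormal (H := relGal h.le)).comp r).ker := by
    rw [hkerK]
    intro σ hσ
    refine MulEquiv.ext fun a => Subtype.ext ?_
    rw [MonoidHom.comp_apply, MulAut.conjNormal_apply]
    exact mul_inv_eq_of_eq_mul (le_centralizer_of_mulEquiv e a.2 _ hσ)
  let φ : Gal(kerField ρ/F) →* MulAut (relGal h.le) := rK.liftOfSurjective hrK ⟨_, hconj⟩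
  have hφ (σ) : φ (rK σ) = MulAut.conjNormal (r σ) :=
    rK.liftOfRightInverse_comp_apply _ _ ⟨_, hconj⟩ σ
  have hφq (g) : φ (q g) = MulAut.conjNormal g := by
    obtain ⟨σ, rfl⟩ := hr g
    rw [hq, hφ]
  let Ψ : relGal h.le ⋊[φ] Gal(kerField ρ/F) →* Gal(D/F) :=
    SemidirectProduct.lift (relGal h.le).subtype s fun k => by
      ext1 a
      have := hφq (s k)
      rw [hqs] at this
      rw [this]
      exact MulAut.conjNormal_apply _ _
  have hΨ (g) : Ψ g = g.left * s g.right := rfl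
  have hqΨ (g) : q (Ψ g) = g.right := by
    rw [hΨ, map_mul, MonoidHom.mem_ker.1 (hqker.ge g.left.2), one_mul,
      hqs]
  have hbij : Function.Bijective Ψ := by
    refine ⟨(injective_iff_map_eq_one _).2 fun g hg => ?_, fun g => ?_⟩
    · have h1 : g.right = 1 := by rw [← hqΨ, hg, map_one]
      rw [hΨ, h1, map_one, mul_one] at hg
      exact SemidirectProduct.ext (Subtype.ext hg) h1
    · have hmem : g * (s (q g))⁻¹ ∈ relGal h.le := by
        rw [← hqker, MonoidHom.mem_ker, map_mul, map_inv, hqs, mul_inv_cancel]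
      refine ⟨⟨⟨_, hmem⟩, q g⟩, ?_⟩
      rw [hΨ]
      exact inv_mul_cancel_right _ _
  refine ⟨φ, fun σ z => ?_, MulEquiv.ofBijective Ψ hbij, fun τ => ?_, fun g z => ?_⟩
  · rw [hφ]
    refine Subtype.ext ?_
    rw [MulAut.conjNormal_apply]
    exact (he σ z).symm
  · refine (hΨ _).trans ?_
    rw [SemidirectProduct.right_inl, map_one, mul_one]
    rfl
  · exact (hq_incl (Ψ g) z).trans (by rw [hqΨ])

end Galois

/-! ### The bijection between isomorphism classes -/

/-- A relation between two types which is total and respects and reflects given equivalence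
relations induces a bijection of the quotients. -/
lemma exists_quotient_equiv {α β : Type*} (sα : Setoid α) (sβ : Setoid β) (R : α → β → Prop)
    (h₁ : ∀ a, ∃ b, R a b) (h₂ : ∀ b, ∃ a, R a b)
    (h₃ : ∀ a a' b b', R a b → R a' b' → (sα a a' ↔ sβ b b'))
    (h₄ : ∀ a b b', R a b → sβ b b' → R a b') :
    ∃ Φ : Quotient sα ≃ Quotient sβ, ∀ a b, Φ (Quotient.mk _ a) = Quotient.mk _ b ↔ R a b := by
  choose f hf using h₁
  let Φ : Quotient sα → Quotient sβ := Quotient.map f fun a a' h =>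
    (h₃ a a' _ _ (hf a) (hf a')).1 h
  refine ⟨Equiv.ofBijective Φ ⟨?_, ?_⟩, fun a b => ?_⟩
  · rintro ⟨a⟩ ⟨a'⟩ h
    exact Quotient.sound ((h₃ a a' _ _ (hf a) (hf a')).2 (Quotient.exact h))
  · rintro ⟨b⟩
    obtain ⟨a, ha⟩ := h₂ b
    exact ⟨Quotient.mk _ a, Quotient.sound ((h₃ a a _ _ (hf a) ha).1 (sα.refl a))⟩
  · refine ⟨fun h => h₄ a _ _ (hf a) (Quotient.exact h), fun h => Quotient.sound ?_⟩
    exact (h₃ a a _ _ (hf a) h).1 (sα.refl a)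

theorem exists_ext_equiv_param {F : Type*} [Field F] {Ft : Type*} [Field Ft] [Algebra F Ft]
    [IsSepClosure F Ft] (l : ℕ) [Fact l.Prime] (n : ℕ) (hn : 0 < n) :
    ∃ Φ : Quotient (Ext.setoid l n F Ft) ≃ Quotient (Param.setoid l n F Ft),
      ∀ (E : Ext l n F Ft) (p : Param l n F Ft),
        Φ (Quotient.mk _ E) = Quotient.mk _ p ↔ IsAttached E.1 p.ρ p.D := by
  refine exists_quotient_equiv _ _ (fun (E : Ext l n F Ft) (p : Param l n F Ft) => IsAttached E.1 p.ρ p.D)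
    (fun E => exists_param_isAttached E.2.1 hn E.2.2) (fun p => ?_) (fun E E' p p' h h' => ?_)
    fun E p p' h hp => p'.isParameter.isAttached (h.closure_eq.trans hp.2)
  · obtain ⟨E, hE, hEn, h⟩ := p.isParameter.exists_isAttached hn
    exact ⟨⟨E, hE, hEn⟩, h⟩
  · constructor
    · rintro ⟨f⟩
      -- Equality of the fields `D` suffices, as `D` determines `ρ` up to isomorphism.
      have hD : p.D = p'.D := by rw [← h.closure_eq, ← h'.closure_eq, normalClosure_congr f]
      exact ⟨p.isParameter.nonempty_equiv (hD ▸ p'.isParameter), hD⟩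
    · rintro ⟨-, hD⟩
      refine nonempty_algEquiv_of_normalClosure_eq E.2.1 E'.2.1 ?_
      rw [h.closure_eq, h'.closure_eq, hD]

end SolvablePrimitive

theorem mainTheorem1 {F : Type u} [Field F] {Ft : Type v} [Field Ft] [Algebra F Ft]
    [IsSepClosure F Ft] (l : ℕ) [Fact l.Prime] (n : ℕ) (hn : 0 < n) :
    -- every pair comes from a solvable primitive extension of degree `l ^ n`, unique up to
    -- `F`-isomorphism, and `Gal(D|F)` is the semidirect product
    (∀ (N : Type w) [AddCommGroup N] [Module (ZMod l) N]
      (ρ : Representation (ZMod l) Gal(Ft/F) N) (D : IntermediateField F Ft)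
      (hP : SolvablePrimitive.IsParameter n ρ D),
      (∃ E : IntermediateField F Ft,
        SolvablePrimitive.IsSolvablePrimitive F Ft E ∧ Module.finrank F E = l ^ n ∧
        SolvablePrimitive.IsAttached E ρ D ∧
        ∀ (E' : Type x) [Field E'] [Algebra F E'],
          SolvablePrimitive.IsSolvablePrimitive F Ft E' →
          IntermediateField.normalClosure F E' Ft = D → Nonempty (E' ≃ₐ[F] E)) ∧
      (haveI := hP.isGalois
        ∀ e : Multiplicative N ≃* SolvablePrimitive.relGal hP.le,
          SolvablePrimitive.ConjugationGivenBy ρ e →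
          ∃ φ : Gal(SolvablePrimitive.kerField ρ/F) →* MulAut (SolvablePrimitive.relGal hP.le),
            (∀ (σ : Gal(Ft/F)) (z : N),
              φ (AlgEquiv.restrictNormalHom (SolvablePrimitive.kerField ρ) σ)
                  (e (Multiplicative.ofAdd z)) = e (Multiplicative.ofAdd (ρ σ z))) ∧
            ∃ Ψ : SolvablePrimitive.relGal hP.le ⋊[φ] Gal(SolvablePrimitive.kerField ρ/F) ≃*
                Gal(D/F),
              (∀ τ : SolvablePrimitive.relGal hP.le,
                Ψ (SemidirectProduct.inl τ) = (τ : Gal(D/F))) ∧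
              (∀ g (z : SolvablePrimitive.kerField ρ),
                Ψ g (IntermediateField.inclusion hP.le z) =
                  IntermediateField.inclusion hP.le (g.right z)))) ∧
    -- conversely, every solvable primitive extension of degree `l ^ n` has an attached pair
    (∀ (E : Type x) [Field E] [Algebra F E],
      SolvablePrimitive.IsSolvablePrimitive F Ft E → Module.finrank F E = l ^ n →
      (∃ p : SolvablePrimitive.Param l n F Ft, SolvablePrimitive.IsAttached E p.ρ p.D) ∧
      ∀ (N : Type w) [AddCommGroup N] [Module (ZMod l) N]
        (ρ : Representation (ZMod l) Gal(Ft/F) N) (D : IntermediateField F Ft),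
        SolvablePrimitive.IsAttached E ρ D → SolvablePrimitive.IsParameter n ρ D) ∧
    -- the attached pair gives a bijection between isomorphism classes
    (∃ Φ : Quotient (SolvablePrimitive.Ext.setoid l n F Ft) ≃
        Quotient (SolvablePrimitive.Param.setoid l n F Ft),
      ∀ (E : SolvablePrimitive.Ext l n F Ft) (p : SolvablePrimitive.Param l n F Ft),
        Φ (Quotient.mk _ E) = Quotient.mk _ p ↔
          SolvablePrimitive.IsAttached E.1 p.ρ p.D) ∧
    -- a solvable primitive extension is determined by its Galois closure
    (∀ (E : Type x) [Field E] [Algebra F E] (E' : Type y) [Field E'] [Algebra F E'],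
      SolvablePrimitive.IsSolvablePrimitive F Ft E →
      SolvablePrimitive.IsSolvablePrimitive F Ft E' →
      IntermediateField.normalClosure F E Ft = IntermediateField.normalClosure F E' Ft →
      Nonempty (E ≃ₐ[F] E')) ∧
    -- the Galois extensions which are Galois closures of such extensions
    (∀ D : IntermediateField F Ft, IsGalois F D →
      ((∃ E : IntermediateField F Ft, SolvablePrimitive.IsSolvablePrimitive F Ft E ∧
          Module.finrank F E = l ^ n ∧ IntermediateField.normalClosure F E Ft = D) ↔
        ∃ ρ : Representation (ZMod l) Gal(Ft/F) (Fin n → ZMod l),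
          SolvablePrimitive.IsParameter n ρ D)) := by
  refine ⟨fun N _ _ ρ D hP => ⟨?_, ?_⟩, fun E _ _ hE hEn => ⟨?_, fun N _ _ ρ D h => ?_⟩,
    SolvablePrimitive.exists_ext_equiv_param l n hn, fun E _ _ E' _ _ hE hE' h =>
      SolvablePrimitive.nonempty_algEquiv_of_normalClosure_eq hE hE' h,
    fun D hD => ⟨?_, ?_⟩⟩
  · obtain ⟨E, hE, hEn, h⟩ := hP.exists_isAttached hn
    exact ⟨E, hE, hEn, h, fun E' _ _ hE' hcl =>
      SolvablePrimitive.nonempty_algEquiv_of_normalClosure_eq hE' hE (hcl.trans h.closure_eq.symm)⟩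
  · have := hP.isGalois
    exact fun e he => hP.exists_semidirectProduct_mulEquiv hn e he
  · exact SolvablePrimitive.exists_param_isAttached hE hn hEn
  · exact h.isParameter hE hEn
  · rintro ⟨E, hE, hEn, rfl⟩
    obtain ⟨p, hp⟩ := SolvablePrimitive.exists_param_isAttached hE hn hEn
    exact ⟨p.ρ, hp.closure_eq ▸ p.isParameter⟩
  · rintro ⟨ρ, h⟩
    obtain ⟨E, hE, hEn, hatt⟩ := h.exists_isAttached hn
    exact ⟨E, hE, hEn, hatt.closure_eq⟩
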